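/- All rings are associative with $1$. A multiplicative set of a ring $R$ is a subset $S$ with $1\in S$, $SS\subseteq S$, $0\notin S$. It is a left Ore set if $Sr\cap Rs\neq\emptyset$ for all $r\in R$, $s\in S$, and a left denominator set if moreover $rs=0$ with $r\in R$, $s\in S$ implies $tr=0$ for some $t\in S$; right Ore and right denominator sets are defined symmetrically. $\mathrm{Ore}(R)$ (resp. $\mathrm{Den}(R)$) is the set of all $S$ that are both left and right Ore (resp. left and right denominator) sets. For a multiplicative set $S$ let $R\langle S^{-1}\rangle$ be the ring freely generated by the ring $R$ and noncommuting indeterminates $x_s$ ($s\in S$), modulo the two-sided ideal generated by all $sx_s-1$ and $x_ss-1$, and let $\mathrm{ass}_R(S)$ be the kernel of $R\to R\langle S^{-1}\rangle$. The set $S$ is left (resp. right) localizable if $R\langle S^{-1}\rangle\ne 0$ and every element of $R\langle S^{-1}\rangle$ has the form $s^{-1}r$ (resp. $rs^{-1}$) with $s\in S$, $r\in R$; it is localizable if it is both. Let $\mathbb L_l(R),\mathbb L_r(R),\mathbb L(R)=\mathbb L_\emptyset(R)$ be the sets of left localizable, right localizable and localizable sets. For $S\in\mathrm{Ore}(R)$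 write $S^{-1}R:=R\langle S^{-1}\rangle$. For a family of sets, $\max$ denotes its set of maximal elements with respect to inclusion. Let $\mathcal C_R$ be the set of regular elements (neither left nor right zero divisors) of $R$, $\min(R)$ the set of minimal prime ideals, and $\mathcal C(\mathfrak p)=\{c\in R\mid c+\mathfrak p\in\mathcal C_{R/\mathfrak p}\}$. **Theorem.** Let $R\ne 0$ be a semiprime (left and right) Goldie ring and, for $*\in\{l,r,\emptyset\}$, let $\mathcal N_*=\{S\in\max\mathbb L_*(R)\mid \mathcal C_R\subseteq S\}$. Then: 1. $\max\mathrm{Ore}(R)=\max\mathrm{Den}(R)=\{\mathcal C(\mathfrak p)\mid\mathfrak p\in\min(R)\}=\mathcal N_*$ for each $*\in\{l,r,\emptyset\}$. 2. For every $S\in\max\mathrm{Ore}(R)$ the ring $S^{-1}R$ is simple Artinian. 3. $\mathcal C_R\in\mathrm{Den}(R)$, and for the classical quotient ring $Q_{cl}(R):=\mathcal C_R^{-1}R\simeq R\mathcal C_R^{-1}$ one has $Q_{cl}(R)\simeq\prod_{S\in\max\mathrm{Ore}(R)}S^{-1}R$; all these isomorphisms can be chosen compatible with the canonical maps from $R$.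 4. $\max\{\mathrm{ass}_R(S)\mid S\in\mathrm{Ore}(R)\}=\{\mathrm{ass}_R(S)\mid S\in\max\mathrm{Ore}(R)\}=\min(R)$. In particular, the ideals $\mathrm{ass}_R(S)$, $S\in\max\mathrm{Ore}(R)$, are pairwise incomparable. -/

import Mathlib

noncomputable section

namespace LocSets

universe u v

/-! ### The ring obtained from `R` by universally inverting a multiplicative set -/

/-- The relations which make the free ring on the disjoint union of `R` and `X` into the ring
freely generated by the ring `R` and the set `X` of noncommuting indeterminates. -/
inductive FreeExtRel (R : Type u) [Ring R] (X : Type v) :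
    FreeAlgebra ℤ (R ⊕ X) → FreeAlgebra ℤ (R ⊕ X) → Prop
  | one : FreeExtRel R X (FreeAlgebra.ι ℤ (Sum.inl 1)) 1
  | add (a b : R) : FreeExtRel R X (FreeAlgebra.ι ℤ (Sum.inl (a + b)))
      (FreeAlgebra.ι ℤ (Sum.inl a) + FreeAlgebra.ι ℤ (Sum.inl b))
  | mul (a b : R) : FreeExtRel R X (FreeAlgebra.ι ℤ (Sum.inl (a * b)))
      (FreeAlgebra.ι ℤ (Sum.inl a) * FreeAlgebra.ι ℤ (Sum.inl b))

/-- `R⟨X⟩`: the ring freely generated by the ring `R` and the set `X` of free noncommutative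
indeterminates (which are not assumed to commute with the elements of `R`). -/
def FreeExt (R : Type u) [Ring R] (X : Type v) : Type (max u v) :=
  RingQuot (FreeExtRel R X)

instance (R : Type u) [Ring R] (X : Type v) : Ring (FreeExt R X) :=
  inferInstanceAs (Ring (RingQuot (FreeExtRel R X)))

/-- The canonical ring homomorphism `R → R⟨X⟩`. -/
def FreeExt.of (R : Type u) [Ring R] (X : Type v) : R →+* FreeExt R X :=
  RingHom.mk'
    { toFun := fun r => RingQuot.mkRingHom (FreeExtRel R X) (FreeAlgebra.ι ℤ (Sum.inl r))
      map_one' := (RingQuot.mkRingHom_rel FreeExtRel.one).trans (map_one _)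
      map_mul' := fun a b => (RingQuot.mkRingHom_rel (FreeExtRel.mul a b)).trans (map_mul _ _ _) }
    (fun a b => (RingQuot.mkRingHom_rel (FreeExtRel.add a b)).trans (map_add _ _ _))

/-- The indeterminates of `R⟨X⟩`. -/
def FreeExt.var (R : Type u) [Ring R] {X : Type v} (x : X) : FreeExt R X :=
  RingQuot.mkRingHom (FreeExtRel R X) (FreeAlgebra.ι ℤ (Sum.inr x))

/-- The relations `s x_s = 1` and `x_s s = 1` for `s ∈ S`. -/
inductive InvertRel {R : Type u} [Ring R] (S : Submonoid R) : FreeExt R S → FreeExt R S → Prop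
  | mul_var (s : S) : InvertRel S (FreeExt.of R S (s : R) * FreeExt.var R s) 1
  | var_mul (s : S) : InvertRel S (FreeExt.var R s * FreeExt.of R S (s : R)) 1

/-- `R⟨S⁻¹⟩`: the quotient of `R⟨x_s : s ∈ S⟩` by the two-sided ideal generated by the elements
`s x_s - 1` and `x_s s - 1`, `s ∈ S`. -/
def Localize {R : Type u} [Ring R] (S : Submonoid R) : Type u :=
  RingQuot (InvertRel S)

instance {R : Type u} [Ring R] (S : Submonoid R) : Ring (Localize S) :=
  inferInstanceAs (Ring (RingQuot (InvertRel S)))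

/-- The canonical ring homomorphism `R → R⟨S⁻¹⟩`. -/
def Localize.of {R : Type u} [Ring R] (S : Submonoid R) : R →+* Localize S :=
  (RingQuot.mkRingHom (InvertRel S)).comp (FreeExt.of R S)

/-- The element `s⁻¹` of `R⟨S⁻¹⟩`, that is, the class of `x_s`. -/
def Localize.inv {R : Type u} [Ring R] {S : Submonoid R} (s : S) : Localize S :=
  RingQuot.mkRingHom (InvertRel S) (FreeExt.var R s)

/-- `ass_R(S)`: the kernel of `R → R⟨S⁻¹⟩`. -/
def ass {R : Type u} [Ring R] (S : Submonoid R) : TwoSidedIdeal R :=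
  TwoSidedIdeal.ker (Localize.of S)

/-! ### Ore sets, denominator sets and localizable sets

A multiplicative set is a submonoid `S` (so `1 ∈ S` and `S S ⊆ S`) with `0 ∉ S`. -/

section Sets

variable (R : Type u) [Ring R]

/-- The left Ore sets: `S r ∩ R s ≠ ∅` for all `r ∈ R`, `s ∈ S`. -/
def leftOre : Set (Submonoid R) :=
  {S | (0 : R) ∉ S ∧ ∀ r : R, ∀ s ∈ S, ∃ s' ∈ S, ∃ r' : R, s' * r = r' * s}

/-- The right Ore sets: `r S ∩ s R ≠ ∅` for all `r ∈ R`, `s ∈ S`. -/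
def rightOre : Set (Submonoid R) :=
  {S | (0 : R) ∉ S ∧ ∀ r : R, ∀ s ∈ S, ∃ s' ∈ S, ∃ r' : R, r * s' = s * r'}

/-- `Ore(R)`: the (left and right) Ore sets of `R`. -/
def ore : Set (Submonoid R) := leftOre R ∩ rightOre R

/-- The left denominator sets. -/
def leftDen : Set (Submonoid R) :=
  {S | S ∈ leftOre R ∧ ∀ r : R, ∀ s ∈ S, r * s = 0 → ∃ t ∈ S, t * r = 0}

/-- The right denominator sets. -/
def rightDen : Set (Submonoid R) :=
  {S | S ∈ rightOre R ∧ ∀ r : R, ∀ s ∈ S, s * r = 0 → ∃ t ∈ S, r * t = 0}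

/-- `Den(R)`: the (left and right) denominator sets of `R`. -/
def den : Set (Submonoid R) := leftDen R ∩ rightDen R

/-- `𝕃_l(R)`: the left localizable sets, for which `R⟨S⁻¹⟩` is nonzero and each of its elements is
a left fraction `s⁻¹ r`. -/
def leftLocalizable : Set (Submonoid R) :=
  {S | (0 : R) ∉ S ∧ Nontrivial (Localize S) ∧
    ∀ q : Localize S, ∃ (s : S) (r : R), q = Localize.inv s * Localize.of S r}

/-- `𝕃_r(R)`: the right localizable sets, for which `R⟨S⁻¹⟩` is nonzero and each of its elements
is a right fraction `r s⁻¹`. -/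
def rightLocalizable : Set (Submonoid R) :=
  {S | (0 : R) ∉ S ∧ Nontrivial (Localize S) ∧
    ∀ q : Localize S, ∃ (s : S) (r : R), q = Localize.of S r * Localize.inv s}

/-- `𝕃(R)`: the localizable sets. -/
def localizable : Set (Submonoid R) := leftLocalizable R ∩ rightLocalizable R

end Sets

/-- The set of maximal elements of a family, with respect to inclusion. -/
def maxElts {α : Type u} [LE α] (F : Set α) : Set α := {S | Maximal (· ∈ F) S}

/-! ### Prime ideals, semiprime Goldie rings -/

/-- A two-sided ideal `P ≠ R` is prime if `a R b ⊆ P` implies `a ∈ P` or `b ∈ P`. -/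
def IsPrimeIdeal {R : Type u} [Ring R] (P : TwoSidedIdeal R) : Prop :=
  P ≠ ⊤ ∧ ∀ a b : R, (∀ r : R, a * r * b ∈ P) → a ∈ P ∨ b ∈ P

/-- `min(R)`: the set of minimal prime ideals of `R`. -/
def minPrimes (R : Type u) [Ring R] : Set (TwoSidedIdeal R) := {P | Minimal IsPrimeIdeal P}

/-- `C(P) = {c ∈ R | c + P is a regular element of R/P}`. -/
def regularMod {R : Type u} [Ring R] (P : TwoSidedIdeal R) : Submonoid R :=
  (nonZeroDivisors P.ringCon.Quotient).comap P.ringCon.mk'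

/-- A ring is semiprime if `a R a = 0` implies `a = 0`. -/
def IsSemiprime (R : Type u) [Ring R] : Prop :=
  ∀ a : R, (∀ r : R, a * r * a = 0) → a = 0

/-- The left annihilator `{r ∈ R | r X = 0}` of a subset `X`, a left ideal. -/
def leftAnn {R : Type u} [Ring R] (X : Set R) : Ideal R where
  carrier := {r | ∀ x ∈ X, r * x = 0}
  add_mem' := fun ha hb x hx => by rw [add_mul, ha x hx, hb x hx, add_zero]
  zero_mem' := fun x _ => zero_mul x
  smul_mem' := fun c r hr x hx => by rw [smul_eq_mul, mul_assoc, hr x hx, mul_zero]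

/-- Left Goldie: finite left uniform dimension (there is no infinite direct sum of nonzero left
ideals inside `R`) and the ascending chain condition on left annihilators. -/
def IsLeftGoldie (R : Type u) [Ring R] : Prop :=
  (∀ I : ℕ → Ideal R, iSupIndep I → ∃ n, I n = ⊥) ∧
  (∀ I : ℕ →o Ideal R, (∀ n, ∃ X : Set R, I n = leftAnn X) → ∃ n, ∀ m, n ≤ m → I m = I n)

/-- Goldie: left Goldie and right Goldie. -/
def IsGoldie (R : Type u) [Ring R] : Prop := IsLeftGoldie R ∧ IsLeftGoldie Rᵐᵒᵖ

/-- A simple ring which is left and right Artinian. -/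
def IsSimpleArtinian (A : Type u) [Ring A] : Prop :=
  IsSimpleRing A ∧ IsArtinianRing A ∧ IsArtinianRing Aᵐᵒᵖ

/-! ### Ore's rings of left and right fractions, classical quotient rings -/

section Fractions

variable {R : Type u} [Ring R] {S : Submonoid R}

lemma nonempty_oreSet (h : S ∈ leftDen R) : Nonempty (OreLocalization.OreSet S) := by
  rw [OreLocalization.nonempty_oreSet_iff]
  refine ⟨fun r₁ r₂ s hs => ?_, fun r s => ?_⟩
  · obtain ⟨t, ht, h0⟩ := h.2 (r₁ - r₂) s s.2 (by rw [sub_mul, hs, sub_self])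
    exact ⟨⟨t, ht⟩, by rwa [mul_sub, sub_eq_zero] at h0⟩
  · obtain ⟨s', hs', r', e⟩ := h.1.2 r s s.2
    exact ⟨r', ⟨s', hs'⟩, e⟩

lemma op_mem_leftDen (h : S ∈ rightDen R) : S.op ∈ leftDen Rᵐᵒᵖ := by
  refine ⟨⟨fun h0 => h.1.1 (by simpa using h0), fun r s hs => ?_⟩, fun r s hs e => ?_⟩
  · obtain ⟨s', hs', r', e⟩ := h.1.2 r.unop s.unop hs
    exact ⟨.op s', hs', .op r', MulOpposite.unop_injective e⟩
  · obtain ⟨t, ht, e'⟩ := h.2 r.unop s.unop hs (congrArg MulOpposite.unop e)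
    exact ⟨.op t, ht, MulOpposite.unop_injective e'⟩

/-- Ore's ring of left fractions `S⁻¹R` at a left denominator set `S`. -/
def LeftFrac (S : Submonoid R) (h : S ∈ leftDen R) : Type u :=
  @OreLocalization R _ S (nonempty_oreSet h).some R _

instance (h : S ∈ leftDen R) : Ring (LeftFrac S h) :=
  letI := (nonempty_oreSet h).some
  inferInstanceAs (Ring (OreLocalization S R))

/-- The canonical homomorphism `R → S⁻¹R`. -/
def LeftFrac.of (h : S ∈ leftDen R) : R →+* LeftFrac S h :=
  letI := (nonempty_oreSet h).some
  (OreLocalization.numeratorRingHom : R →+* OreLocalization S R)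

/-- Ore's ring of right fractions `RS⁻¹` at a right denominator set `S`: the opposite of the ring
of left fractions of the opposite ring. -/
abbrev RightFrac (S : Submonoid R) (h : S ∈ rightDen R) : Type u :=
  (LeftFrac S.op (op_mem_leftDen h))ᵐᵒᵖ

/-- The canonical homomorphism `R → RS⁻¹`. -/
def RightFrac.of (h : S ∈ rightDen R) : R →+* RightFrac S h :=
  (LeftFrac.of (op_mem_leftDen h)).op.comp (RingEquiv.opOp R).toRingHom

end Fractions

end LocSets

end

/-!
By Goldie's theorem the regular elements of `R` form a denominator set whose ring of fractions is
a finite product `∏ A i` of simple Artinian rings. Let `K i` be the kernel of the canonical map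
`R → A i` and `C i` the set of elements of `R` which become units in `A i`. Lifting the central
idempotents of the product to `R`, up to regular denominators, shows that `A i` is also the ring
of fractions of `R` at `C i`. As `A i` is Artinian, right multiplication by a unit is surjective
on every left ideal which it preserves, so a left ideal of `A i` stable under right multiplication
by `R` is two-sided; simplicity of `A i` then makes `K i` prime. The `K i` are pairwise
incomparable with zero intersection, hence they are exactly the minimal primes, and `C i` is the
set of elements regular modulo `K i`.

It remains to put an arbitrary `S` inside some `C i`. If `S` is Ore, the chain condition on left
annihilators makes it a denominator set and provides `s₀ ∈ S` such that `r s₀ = 0` whenever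
`r s = 0` for some `s ∈ S`. For `i` with `s₀ ∉ K i`, primeness of `K i` puts all such `r` in `K i`,
so the image of `S` in `A i` consists of regular elements, which are units there. If instead `S`
contains the regular elements and `R⟨S⁻¹⟩ ≠ 0`, then `∏ A i` maps to `R⟨S⁻¹⟩` and by simplicity
some `A i` embeds, so that the elements of `S` are again regular in `A i`.
-/

universe u

namespace LocSets

/-! ### Essential submodules and Goldie's theorem -/

section Essential

variable {R M M' : Type*} [Ring R] [AddCommGroup M] [Module R M] [AddCommGroup M'] [Module R M']

/-- A submodule is essential if it meets every nonzero submodule nontrivially. -/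
def IsEssential (N : Submodule R M) : Prop :=
  ∀ P : Submodule R M, Disjoint N P → P = ⊥

lemma isEssential_iff_exists_smul {N : Submodule R M} :
    IsEssential N ↔ ∀ x : M, x ≠ 0 → ∃ r : R, r • x ≠ 0 ∧ r • x ∈ N := by
  constructor
  · intro h x hx
    by_contra! hN
    refine hx <| Submodule.span_singleton_eq_bot.1 <| h _ <|
      Submodule.disjoint_def.2 fun y hyN hy => ?_
    obtain ⟨r, rfl⟩ := Submodule.mem_span_singleton.1 hy
    by_contra h0
    exact hN r h0 hyN
  · intro h P hP
    refine (Submodule.eq_bot_iff P).2 fun x hx => ?_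
    by_contra h0
    obtain ⟨r, hr, hrN⟩ := h x h0
    exact hr (Submodule.disjoint_def.1 hP _ hrN (P.smul_mem r hx))

lemma IsEssential.mono {N N' : Submodule R M} (h : IsEssential N) (hle : N ≤ N') :
    IsEssential N' :=
  fun P hP => h P (hP.mono_left hle)

lemma IsEssential.comap {N : Submodule R M'} (h : IsEssential N) (f : M →ₗ[R] M') :
    IsEssential (N.comap f) := by
  rw [isEssential_iff_exists_smul] at h ⊢
  intro x hx
  by_cases hfx : f x = 0
  · exact ⟨1, by rwa [one_smul], by simp [hfx]⟩
  · obtain ⟨r, hr, hrN⟩ := h _ hfx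
    rw [← map_smul] at hr hrN
    exact ⟨r, fun h0 => hr (by rw [h0, map_zero]), hrN⟩

lemma exists_disjoint_isEssential_sup (N : Submodule R M) :
    ∃ K : Submodule R M, Disjoint N K ∧ IsEssential (N ⊔ K) := by
  obtain ⟨K, hK⟩ := zorn_le₀ {K : Submodule R M | Disjoint N K} fun c hc hchain =>
    ⟨sSup c, hchain.directedOn.disjoint_sSup_right.2 fun _ hK => hc hK, fun _ hK => le_sSup hK⟩
  refine ⟨K, hK.1, fun P hP => ?_⟩
  have hPK : P ≤ K :=
    le_sup_right.trans (hK.2 (hK.1.disjoint_sup_right_of_disjoint_sup_left hP) le_sup_left)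
  exact (hP.mono_left (hPK.trans le_sup_right)).eq_bot_of_self

lemma iSupIndep_of_disjoint_iSup_gt {ι : Type*} [LinearOrder ι] {N : ι → Submodule R M}
    (h : ∀ i, Disjoint (N i) (⨆ j > i, N j)) : iSupIndep N := by
  classical
  rw [iSupIndep_iff_finsetSum_eq_zero_imp_eq_zero]
  intro s
  induction s using Finset.induction_on_min with
  | empty => simp
  | insert i s hi ih =>
    intro v hv hsum
    rw [Finset.sum_insert fun his => lt_irrefl i (hi i his)] at hsum
    have htail : ∑ j ∈ s, v j ∈ ⨆ j > i, N j := sum_mem fun j hj =>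
      Submodule.mem_iSup_of_mem j (Submodule.mem_iSup_of_mem (hi j hj)
        (hv j (Finset.mem_insert_of_mem hj)))
    have hvi : v i = 0 := by
      refine Submodule.disjoint_def.1 (h i) _ (hv i (Finset.mem_insert_self i s)) ?_
      rw [eq_neg_of_add_eq_zero_left hsum]
      exact neg_mem htail
    rw [hvi, zero_add] at hsum
    have hvs := ih v (fun j hj => hv j (Finset.mem_insert_of_mem hj)) hsum
    exact Finset.forall_mem_insert _ _ _ |>.2 ⟨hvi, hvs⟩

end Essential

section Goldie

variable {R : Type*} [Ring R]

lemma mem_leftAnn_singleton {a x : R} : x ∈ leftAnn {a} ↔ x * a = 0 :=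
  forall_eq

lemma leftAnn_singleton_le_mul (a b : R) : leftAnn {a} ≤ leftAnn {a * b} := fun x hx => by
  rw [mem_leftAnn_singleton] at hx ⊢
  rw [← mul_assoc, hx, zero_mul]

lemma leftAnn_singleton_eq_bot_iff {a : R} : leftAnn {a} = ⊥ ↔ ∀ x, x * a = 0 → x = 0 := by
  simp only [Submodule.eq_bot_iff, mem_leftAnn_singleton]

variable (R) in
/-- The ascending chain condition on left annihilators of single elements, in the form of
well-foundedness of the reverse order. -/
def HasLeftAnnACC : Prop :=
  WellFounded fun a b : R => leftAnn {b} < leftAnn {a}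

variable (R) in
/-- Finite left uniform dimension: no infinite direct sum of nonzero left ideals. -/
def HasFiniteLeftUniformDim : Prop :=
  ∀ I : ℕ → Ideal R, iSupIndep I → ∃ n, I n = ⊥

variable (R) in
/-- A ring is left nonsingular if only `0` has an essential left annihilator. -/
def IsLeftNonsingular : Prop :=
  ∀ z : R, IsEssential (leftAnn {z}) → z = 0

lemma IsLeftGoldie.hasFiniteLeftUniformDim (hG : IsLeftGoldie R) : HasFiniteLeftUniformDim R := hG.1

lemma IsLeftGoldie.hasLeftAnnACC (hG : IsLeftGoldie R) : HasLeftAnnACC R := by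
  refine wellFounded_iff_isEmpty_descending_chain.2 ⟨fun ⟨a, ha⟩ => ?_⟩
  obtain ⟨n, hn⟩ := hG.2 ⟨fun n => leftAnn {a n}, monotone_nat_of_le_succ fun n => (ha n).le⟩
    fun n => ⟨_, rfl⟩
  exact (ha n).ne' (hn (n + 1) n.le_succ)

lemma HasLeftAnnACC.exists_maximal (hR : HasLeftAnnACC R) {s : Set R} (hs : s.Nonempty) :
    ∃ a ∈ s, ∀ b ∈ s, leftAnn {a} ≤ leftAnn {b} → leftAnn {b} ≤ leftAnn {a} := by
  obtain ⟨a, ha, hmax⟩ := hR.has_min s hs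
  exact ⟨a, ha, fun b hb => not_lt_iff_le_imp_ge.1 (hmax b hb)⟩

lemma HasLeftAnnACC.exists_pow_leftAnn_mul_self_le (hR : HasLeftAnnACC R) (b : R) :
    ∃ n ≠ 0, leftAnn {b ^ n * b ^ n} ≤ leftAnn {b ^ n} := by
  obtain ⟨_, ⟨n, hn, rfl⟩, hmax⟩ :=
    hR.exists_maximal (s := {a | ∃ n ≠ 0, a = b ^ n}) ⟨_, 1, one_ne_zero, rfl⟩
  exact ⟨n, hn, hmax _ ⟨n + n, by lia, (pow_add b n n).symm⟩ (leftAnn_singleton_le_mul _ _)⟩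

lemma IsSemiprime.eq_bot_of_forall_isNilpotent (hsp : IsSemiprime R) (hR : HasLeftAnnACC R)
    {L : Ideal R} (hL : ∀ x ∈ L, IsNilpotent x) : L = ⊥ := by
  by_contra hne
  obtain ⟨b, ⟨hb, hb0⟩, hmax⟩ := hR.exists_maximal (s := {b | b ∈ L ∧ b ≠ 0})
    (Submodule.exists_mem_ne_zero_of_ne_bot hne)
  refine hb0 (hsp b fun r => ?_)
  by_contra hbrb
  have hle : leftAnn {b * (r * b)} ≤ leftAnn {b} :=
    hmax _ ⟨L.mul_mem_left b (L.mul_mem_left r hb), by rwa [← mul_assoc]⟩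
      (leftAnn_singleton_le_mul _ _)
  have hpow : ∀ k, (b * r) ^ k * b ≠ 0 := by
    intro k
    induction k with
    | zero => simpa using hb0
    | succ k ih =>
      refine fun h => ih (mem_leftAnn_singleton.1 (hle (mem_leftAnn_singleton.2 ?_)))
      rwa [← mul_assoc b, ← mul_assoc, ← pow_succ]
  obtain ⟨n, hn⟩ := hL _ (L.mul_mem_left r hb)
  exact hpow n (by rw [mul_pow_mul, hn, mul_zero])

lemma HasLeftAnnACC.isNilpotent_of_isEssential_leftAnn (hR : HasLeftAnnACC R) {z : R}
    (hz : IsEssential (leftAnn {z})) : IsNilpotent z := by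
  obtain ⟨n, hn, hle⟩ := hR.exists_pow_leftAnn_mul_self_le z
  refine ⟨n, ?_⟩
  by_contra hzn
  obtain ⟨y, hy, hyz⟩ := isEssential_iff_exists_smul.1 hz _ hzn
  rw [smul_eq_mul] at hy hyz
  obtain ⟨m, rfl⟩ := Nat.exists_eq_succ_of_ne_zero hn
  refine hy (mem_leftAnn_singleton.1 (hle (mem_leftAnn_singleton.2 ?_)))
  rw [← mul_assoc, pow_succ' z m, ← mul_assoc (y * _), ← pow_succ', mem_leftAnn_singleton.1 hyz,
    zero_mul]

lemma IsSemiprime.isLeftNonsingular (hsp : IsSemiprime R) (hR : HasLeftAnnACC R) :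
    IsLeftNonsingular R := by
  intro z hz
  refine Ideal.span_singleton_eq_bot.1 (hsp.eq_bot_of_forall_isNilpotent hR fun x hx => ?_)
  obtain ⟨r, rfl⟩ := Ideal.mem_span_singleton'.1 hx
  obtain ⟨n, hn⟩ :=
    hR.isNilpotent_of_isEssential_leftAnn (hz.mono (leftAnn_singleton_le_mul z r))
  exact ⟨n + 1, by rw [pow_succ, ← mul_assoc, mul_pow_mul, hn, mul_zero, zero_mul]⟩

lemma IsLeftNonsingular.exists_ne_zero_disjoint (hns : IsLeftNonsingular R) {a b : R}
    (hab : leftAnn {b} < leftAnn {a}) :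
    ∃ y ≠ 0, y ∈ leftAnn {a} ∧ Disjoint (Ideal.span {y}) (leftAnn {b}) := by
  obtain ⟨x, hxa, hxb⟩ := SetLike.exists_of_lt hab
  have hess : ¬ IsEssential (leftAnn {x * b}) := fun h => hxb (mem_leftAnn_singleton.2 (hns _ h))
  rw [isEssential_iff_exists_smul] at hess
  push Not at hess
  obtain ⟨r, hr0, hr⟩ := hess
  simp only [smul_eq_mul, mem_leftAnn_singleton] at hr
  refine ⟨r * x, fun h => ?_, Ideal.mul_mem_left _ r hxa,
    Submodule.disjoint_def.2 fun y hy hyb => ?_⟩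
  · exact hr 1 (by rwa [one_mul]) (by rw [one_mul, ← mul_assoc, h, zero_mul])
  · obtain ⟨s, rfl⟩ := Ideal.mem_span_singleton'.1 hy
    by_contra h0
    refine hr s (fun h => h0 (by rw [← mul_assoc, h, zero_mul])) ?_
    simpa only [mul_assoc] using mem_leftAnn_singleton.1 hyb

lemma IsLeftNonsingular.wellFounded_leftAnn_lt (hns : IsLeftNonsingular R)
    (hfin : HasFiniteLeftUniformDim R) : WellFounded fun a b : R => leftAnn {a} < leftAnn {b} := by
  refine wellFounded_iff_isEmpty_descending_chain.2 ⟨fun ⟨a, ha⟩ => ?_⟩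
  choose y hy0 hya hdisj using fun n => hns.exists_ne_zero_disjoint (ha n)
  have hanti : Antitone fun n => leftAnn {a n} := antitone_nat_of_succ_le fun n => (ha n).le
  obtain ⟨n, hn⟩ := hfin (fun n => Ideal.span {y n}) <|
    iSupIndep_of_disjoint_iSup_gt fun i => (hdisj i).mono_right <| iSup₂_le fun j hj =>
      ((Ideal.span_singleton_le_iff_mem _).2 (hya j)).trans (hanti hj)
  exact hy0 n (Ideal.span_singleton_eq_bot.1 hn)

lemma leftAnn_add_of_mul_eq_zero {a c : R} (ha : leftAnn {a * a} ≤ leftAnn {a})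
    (hca : c * a = 0) : leftAnn {a + c} = leftAnn {a} ⊓ leftAnn {c} := by
  refine le_antisymm (fun x hx => ?_) fun x hx => ?_
  · rw [mem_leftAnn_singleton, mul_add] at hx
    have hxaa : x * (a * a) = 0 := by
      simpa only [add_mul, mul_assoc, hca, mul_zero, add_zero, zero_mul] using congrArg (· * a) hx
    have hxa : x * a = 0 := mem_leftAnn_singleton.1 (ha (mem_leftAnn_singleton.2 hxaa))
    exact ⟨mem_leftAnn_singleton.2 hxa, mem_leftAnn_singleton.2 (by rwa [hxa, zero_add] at hx)⟩
  · rw [mem_leftAnn_singleton, mul_add, mem_leftAnn_singleton.1 hx.1, mem_leftAnn_singleton.1 hx.2,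
      add_zero]

lemma leftAnn_add_mul_self_le {a c : R} (ha : leftAnn {a * a} ≤ leftAnn {a})
    (hc : leftAnn {c * c} ≤ leftAnn {c}) (hca : c * a = 0) :
    leftAnn {(a + c) * (a + c)} ≤ leftAnn {a + c} := by
  intro x hx
  have hx' : x * (a + c) ∈ leftAnn {a + c} := by
    rwa [mem_leftAnn_singleton, mul_assoc, ← mem_leftAnn_singleton]
  rw [leftAnn_add_of_mul_eq_zero ha hca] at hx' ⊢
  have hxa : x ∈ leftAnn {a} := ha <| mem_leftAnn_singleton.2 <| by
    simpa only [add_mul, mul_add, mul_assoc, hca, mul_zero, add_zero] using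
      mem_leftAnn_singleton.1 hx'.1
  have hxc : x ∈ leftAnn {c} := hc <| mem_leftAnn_singleton.2 <| by
    simpa only [mul_add, mem_leftAnn_singleton.1 hxa, zero_add, mul_assoc] using
      mem_leftAnn_singleton.1 hx'.2
  exact ⟨hxa, hxc⟩

lemma IsEssential.exists_mem_leftAnn_eq_bot (hsp : IsSemiprime R) (hR : HasLeftAnnACC R)
    (hfin : HasFiniteLeftUniformDim R) {E : Ideal R} (hE : IsEssential E) :
    ∃ a ∈ E, leftAnn {a} = ⊥ := by
  obtain ⟨a, ⟨haE, ha⟩, hmin⟩ :=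
    ((hsp.isLeftNonsingular hR).wellFounded_leftAnn_lt hfin).has_min
      {a | a ∈ E ∧ leftAnn {a * a} ≤ leftAnn {a}} ⟨0, E.zero_mem, by rw [mul_zero]⟩
  refine ⟨a, haE, hE _ (disjoint_iff.2 (hsp.eq_bot_of_forall_isNilpotent hR fun b hb => ?_))⟩
  obtain ⟨n, hn, hc⟩ := hR.exists_pow_leftAnn_mul_self_le b
  refine ⟨n, ?_⟩
  have hcE : b ^ n ∈ E ⊓ leftAnn {a} := Ideal.pow_mem_of_mem _ hb n (Nat.pos_of_ne_zero hn)
  have hca : b ^ n * a = 0 := mem_leftAnn_singleton.1 hcE.2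
  -- By minimality `leftAnn {a + bⁿ} = leftAnn {a}`, so `bⁿ` also annihilates itself.
  have hle : leftAnn {a} ≤ leftAnn {a + b ^ n} :=
    not_lt_iff_le_imp_ge.1 (hmin _ ⟨E.add_mem haE hcE.1, leftAnn_add_mul_self_le ha hc hca⟩)
      ((leftAnn_add_of_mul_eq_zero ha hca).trans_le inf_le_left)
  have hcc : b ^ n * b ^ n = 0 := mem_leftAnn_singleton.1
    ((hle.trans ((leftAnn_add_of_mul_eq_zero ha hca).trans_le inf_le_right)) hcE.2)
  simpa using mem_leftAnn_singleton.1 (hc (mem_leftAnn_singleton.2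
    (show 1 * (b ^ n * b ^ n) = 0 by rw [one_mul, hcc])))

/-- For `P` disjoint from `Rc`, the left ideals `P cⁿ` are independent. -/
lemma HasFiniteLeftUniformDim.isEssential_span_singleton (hfin : HasFiniteLeftUniformDim R) {c : R}
    (hc : leftAnn {c} = ⊥) : IsEssential (Ideal.span {c}) := by
  rw [leftAnn_singleton_eq_bot_iff] at hc
  intro P hP
  let ρ : ℕ → R →ₗ[R] R := fun n => LinearMap.toSpanSingleton R R (c ^ n)
  have hρ : ∀ n, Function.Injective (ρ n) := fun n => by
    refine (injective_iff_map_eq_zero _).2 fun x hx => ?_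
    induction n with
    | zero => simpa [ρ] using hx
    | succ n ih => exact ih (hc _ (by simpa [ρ, pow_succ, mul_assoc] using hx))
  have hgt : ∀ i, ⨆ j > i, P.map (ρ j) ≤ Submodule.map (ρ i) (Ideal.span {c}) := by
    intro i
    refine iSup₂_le fun j hj => ?_
    rintro _ ⟨x, -, rfl⟩
    obtain ⟨k, rfl⟩ := Nat.exists_eq_add_of_lt hj
    refine ⟨x * c ^ k * c, Ideal.mul_mem_left _ _ (Ideal.mem_span_singleton_self c), ?_⟩
    simp only [ρ, LinearMap.toSpanSingleton_apply, smul_eq_mul, mul_assoc, ← pow_succ', ← pow_add]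
    congr 2
    lia
  obtain ⟨n, hn⟩ := hfin (fun n => P.map (ρ n)) <| iSupIndep_of_disjoint_iSup_gt fun i =>
    ((Submodule.disjoint_map (hρ i) hP.symm).mono_right (hgt i))
  exact Submodule.map_injective_of_injective (hρ n) (hn.trans (Submodule.map_bot _).symm)

theorem IsEssential.exists_mem_nonZeroDivisors (hsp : IsSemiprime R) (hG : IsLeftGoldie R)
    {E : Ideal R} (hE : IsEssential E) : ∃ c ∈ E, c ∈ nonZeroDivisors R := by
  obtain ⟨c, hcE, hc⟩ :=
    hE.exists_mem_leftAnn_eq_bot hsp hG.hasLeftAnnACC hG.hasFiniteLeftUniformDim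
  refine ⟨c, hcE, mem_nonZeroDivisors_iff.2 ⟨fun x hx => ?_, leftAnn_singleton_eq_bot_iff.1 hc⟩⟩
  refine hsp.isLeftNonsingular hG.hasLeftAnnACC x
    ((hG.hasFiniteLeftUniformDim.isEssential_span_singleton hc).mono ?_)
  rwa [Ideal.span_singleton_le_iff_mem, mem_leftAnn_singleton]

theorem nonZeroDivisors_mem_leftDen [Nontrivial R] (hsp : IsSemiprime R) (hG : IsLeftGoldie R) :
    nonZeroDivisors R ∈ leftDen R := by
  refine ⟨⟨zero_notMem_nonZeroDivisors, fun r s hs => ?_⟩, fun r s hs h => ⟨1, one_mem _, ?_⟩⟩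
  · have hss := hG.hasFiniteLeftUniformDim.isEssential_span_singleton
      (leftAnn_singleton_eq_bot_iff.2 (mem_nonZeroDivisors_iff.1 hs).2)
    obtain ⟨c, hcr, hc⟩ := (hss.comap (LinearMap.toSpanSingleton R R r)).exists_mem_nonZeroDivisors
      hsp hG
    obtain ⟨r', hr'⟩ := Ideal.mem_span_singleton'.1 (Submodule.mem_comap.1 hcr)
    exact ⟨c, hc, r', hr'.symm⟩
  · rw [(mem_nonZeroDivisors_iff.1 hs).2 r h, mul_zero]

lemma IsSemiprime.op (hsp : IsSemiprime R) : IsSemiprime Rᵐᵒᵖ := fun a h =>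
  MulOpposite.unop_injective <| hsp _ fun r => by
    rw [mul_assoc]
    exact congrArg MulOpposite.unop (h (.op r))

lemma mem_rightOre_iff_op {S : Submonoid R} : S ∈ rightOre R ↔ S.op ∈ leftOre Rᵐᵒᵖ := by
  simp only [rightOre, leftOre, Set.mem_ofPred_eq, MulOpposite.forall, MulOpposite.exists,
    Submonoid.mem_op, MulOpposite.unop_op, MulOpposite.unop_zero, ← MulOpposite.op_mul,
    MulOpposite.op_inj]

lemma mem_rightDen_iff_op {S : Submonoid R} : S ∈ rightDen R ↔ S.op ∈ leftDen Rᵐᵒᵖ := by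
  simp only [rightDen, leftDen, Set.mem_ofPred_eq, mem_rightOre_iff_op, MulOpposite.forall,
    MulOpposite.exists, Submonoid.mem_op, MulOpposite.unop_op, ← MulOpposite.op_mul,
    MulOpposite.op_eq_zero_iff]

lemma op_nonZeroDivisors : (nonZeroDivisors R).op = nonZeroDivisors Rᵐᵒᵖ := by
  ext x
  simp only [Submonoid.mem_op, mem_nonZeroDivisors_iff, MulOpposite.forall,
    ← MulOpposite.unop_eq_zero_iff, MulOpposite.unop_mul, MulOpposite.unop_op]
  exact and_comm

theorem nonZeroDivisors_mem_rightDen [Nontrivial R] (hsp : IsSemiprime R)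
    (hG : IsLeftGoldie Rᵐᵒᵖ) : nonZeroDivisors R ∈ rightDen R := by
  rw [mem_rightDen_iff_op, op_nonZeroDivisors]
  exact nonZeroDivisors_mem_leftDen hsp.op hG

end Goldie

/-! ### Universal localizations and rings of fractions -/

section Localize

variable {R A : Type*} [Ring R] [Ring A] {X : Type*} {S : Submonoid R}

/-- The homomorphism `R⟨X⟩ → A` extending a homomorphism `R → A` and a map `X → A`. -/
noncomputable def FreeExt.lift (f : R →+* A) (g : X → A) : FreeExt R X →+* A :=
  RingQuot.lift ⟨(FreeAlgebra.lift ℤ (Sum.elim f g) : FreeAlgebra ℤ (R ⊕ X) →ₐ[ℤ] A), by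
    intro x y h
    cases h <;> simp⟩

lemma FreeExt.lift_of (f : R →+* A) (g : X → A) (r : R) :
    FreeExt.lift f g (FreeExt.of R X r) = f r := by
  change RingQuot.lift _ (RingQuot.mkRingHom _ _) = _
  rw [RingQuot.lift_mkRingHom_apply]
  simp

lemma FreeExt.lift_var (f : R →+* A) (g : X → A) (x : X) :
    FreeExt.lift f g (FreeExt.var R x) = g x := by
  change RingQuot.lift _ (RingQuot.mkRingHom _ _) = _
  rw [RingQuot.lift_mkRingHom_apply]
  simp

lemma FreeExt.hom_ext {g h : FreeExt R X →+* A}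
    (hof : ∀ r, g (FreeExt.of R X r) = h (FreeExt.of R X r))
    (hvar : ∀ x, g (FreeExt.var R x) = h (FreeExt.var R x)) : g = h := by
  refine RingQuot.ringQuot_ext _ _ ?_
  have hAlg : (g.comp (RingQuot.mkRingHom _)).toIntAlgHom =
      (h.comp (RingQuot.mkRingHom (FreeExtRel R X))).toIntAlgHom :=
    FreeAlgebra.hom_ext (funext fun x => x.casesOn hof hvar)
  exact RingHom.ext fun x => DFunLike.congr_fun hAlg x

lemma Localize.of_mul_inv (s : S) : Localize.of S (s : R) * Localize.inv s = 1 :=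
  (map_mul _ _ _).symm.trans ((RingQuot.mkRingHom_rel (InvertRel.mul_var s)).trans (map_one _))

lemma Localize.inv_mul_of (s : S) : Localize.inv s * Localize.of S (s : R) = 1 :=
  (map_mul _ _ _).symm.trans ((RingQuot.mkRingHom_rel (InvertRel.var_mul s)).trans (map_one _))

lemma Localize.isUnit_of {s : R} (hs : s ∈ S) : IsUnit (Localize.of S s) :=
  ⟨⟨_, _, Localize.of_mul_inv ⟨s, hs⟩, Localize.inv_mul_of ⟨s, hs⟩⟩, rfl⟩

lemma Localize.exists_lift {f : R →+* A} (hf : ∀ s ∈ S, IsUnit (f s)) :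
    ∃ g : Localize S →+* A, ∀ r, g (Localize.of S r) = f r := by
  let k : FreeExt R S →+* A := FreeExt.lift f fun s => ((hf s s.2).unit⁻¹ : Aˣ)
  have hk : ∀ ⦃x y⦄, InvertRel S x y → k x = k y := by
    rintro _ _ (s | s) <;>
      simp only [k, map_mul, map_one, FreeExt.lift_of, FreeExt.lift_var, IsUnit.mul_val_inv,
        IsUnit.val_inv_mul]
  refine ⟨RingQuot.lift ⟨k, hk⟩, fun r => ?_⟩
  change RingQuot.lift _ (RingQuot.mkRingHom _ _) = _
  rw [RingQuot.lift_mkRingHom_apply]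
  exact FreeExt.lift_of _ _ _

lemma Localize.hom_ext {g h : Localize S →+* A}
    (hof : ∀ r, g (Localize.of S r) = h (Localize.of S r)) : g = h := by
  refine RingQuot.ringQuot_ext _ _ (FreeExt.hom_ext hof fun s => ?_)
  change g (Localize.inv s) = h (Localize.inv s)
  refine ((Localize.isUnit_of s.2).map g).mul_left_cancel ?_
  rw [← map_mul, Localize.of_mul_inv, hof, ← map_mul, Localize.of_mul_inv, map_one, map_one]

end Localize

section Fractions

variable {R Q : Type*} [Ring R] [Ring Q] {S : Submonoid R} {φ : R →+* Q}

/-- `φ : R → Q` exhibits `Q` as a ring of left fractions of `R` at `S`, up to isomorphism. -/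
structure IsLeftFractionRing (S : Submonoid R) (φ : R →+* Q) : Prop where
  isUnit : ∀ s ∈ S, IsUnit (φ s)
  exists_mul_eq : ∀ q, ∃ s ∈ S, ∃ r, φ s * q = φ r
  exists_mul_eq_zero : ∀ r, φ r = 0 → ∃ s ∈ S, s * r = 0

/-- `φ : R → Q` exhibits `Q` as a ring of right fractions of `R` at `S`, up to isomorphism. -/
structure IsRightFractionRing (S : Submonoid R) (φ : R →+* Q) : Prop where
  isUnit : ∀ s ∈ S, IsUnit (φ s)
  exists_mul_eq : ∀ q, ∃ s ∈ S, ∃ r, q * φ s = φ r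
  exists_mul_eq_zero : ∀ r, φ r = 0 → ∃ s ∈ S, r * s = 0

lemma LeftFrac.isLeftFractionRing (h : S ∈ leftDen R) : IsLeftFractionRing S (LeftFrac.of h) := by
  let := (nonempty_oreSet h).some
  refine ⟨fun s hs => OreLocalization.numerator_isUnit (⟨s, hs⟩ : S), fun q => ?_, fun r hr => ?_⟩
  · change OreLocalization S R at q
    induction q with | _ r s
    refine ⟨s, s.2, r, ?_⟩
    change ((s : R) /ₒ (1 : S) : OreLocalization S R) * (r /ₒ s) = r /ₒ (1 : S)
    exact OreLocalization.mul_cancel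
  · have hr' : (0 : R) /ₒ (1 : S) = r /ₒ (1 : S) := (OreLocalization.zero_oreDiv' 1).trans hr.symm
    obtain ⟨u, _, hur, -⟩ := OreLocalization.oreDiv_eq_iff.1 hr'
    refine ⟨u, u.2, ?_⟩
    simpa [Submonoid.smul_def] using hur

lemma LeftFrac.exists_lift {A : Type*} [Ring A] (h : S ∈ leftDen R) {f : R →+* A}
    (hf : ∀ s ∈ S, IsUnit (f s)) : ∃ g : LeftFrac S h →+* A, ∀ r, g (LeftFrac.of h r) = f r := by
  let := (nonempty_oreSet h).some
  exact ⟨OreLocalization.universalHom f (IsUnit.liftRight ((f : R →* A).comp S.subtype)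
    fun s => hf s s.2) fun s => rfl, fun r => OreLocalization.universalHom_commutes _ _ _⟩

namespace IsLeftFractionRing

lemma comp_ringEquiv {Q' : Type*} [Ring Q'] (hφ : IsLeftFractionRing S φ) (e : Q ≃+* Q') :
    IsLeftFractionRing S ((e : Q →+* Q').comp φ) where
  isUnit s hs := (hφ.isUnit s hs).map e
  exists_mul_eq q := by
    obtain ⟨s, hs, r, h⟩ := hφ.exists_mul_eq (e.symm q)
    exact ⟨s, hs, r, by simpa using congrArg e h⟩
  exists_mul_eq_zero r hr := hφ.exists_mul_eq_zero r (e.map_eq_zero_iff.1 hr)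

lemma injective (hφ : IsLeftFractionRing S φ) (hS : S ≤ nonZeroDivisors R) :
    Function.Injective φ := by
  refine (injective_iff_map_eq_zero φ).2 fun r hr => ?_
  obtain ⟨s, hs, hsr⟩ := hφ.exists_mul_eq_zero r hr
  exact (mem_nonZeroDivisors_iff.1 (hS hs)).1 r hsr

lemma nontrivial {A : Type*} [Ring A] [Nontrivial A] (hφ : IsLeftFractionRing S φ) {f : R →+* A}
    (hf : ∀ s ∈ S, IsUnit (f s)) : Nontrivial Q := by
  by_contra hQ
  rw [not_nontrivial_iff_subsingleton] at hQ
  obtain ⟨s, hs, hs0⟩ := hφ.exists_mul_eq_zero 1 (Subsingleton.elim _ _)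
  have h0 := hf s hs
  rw [← mul_one s, hs0, map_zero] at h0
  exact not_isUnit_zero h0

lemma hom_ext {A : Type*} [Ring A] (hφ : IsLeftFractionRing S φ) {g h : Q →+* A}
    (hgh : ∀ r, g (φ r) = h (φ r)) : g = h := by
  ext q
  obtain ⟨s, hs, r, e⟩ := hφ.exists_mul_eq q
  refine ((hφ.isUnit s hs).map g).mul_left_cancel ?_
  rw [← map_mul, e, hgh, hgh, ← map_mul, e]

lemma bijective_of_comp_eq {Q' : Type*} [Ring Q'] {ψ : R →+* Q'} (hφ : IsLeftFractionRing S φ)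
    (hψ : IsLeftFractionRing S ψ) {g : Q →+* Q'} (hg : ∀ r, g (φ r) = ψ r) :
    Function.Bijective g := by
  constructor
  · refine (injective_iff_map_eq_zero g).2 fun q hq => ?_
    obtain ⟨s, hs, r, e⟩ := hφ.exists_mul_eq q
    have hr : ψ r = 0 := by rw [← hg, ← e, map_mul, hq, mul_zero]
    obtain ⟨t, ht, htr⟩ := hψ.exists_mul_eq_zero r hr
    have hφr : φ r = 0 := (hφ.isUnit t ht).mul_right_eq_zero.1 (by rw [← map_mul, htr, map_zero])
    exact (hφ.isUnit s hs).mul_right_eq_zero.1 (e.trans hφr)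
  · intro q
    obtain ⟨s, hs, r, e⟩ := hψ.exists_mul_eq q
    obtain ⟨u, hu⟩ := hφ.isUnit s hs
    refine ⟨(u⁻¹ : Qˣ) * φ r, (hψ.isUnit s hs).mul_left_cancel ?_⟩
    rw [e, ← hg s, ← map_mul, ← hu, Units.mul_inv_cancel_left, hg]

lemma mem_leftDen [Nontrivial Q] (hφ : IsLeftFractionRing S φ) : S ∈ leftDen R := by
  refine ⟨⟨fun h0 => ?_, fun r s hs => ?_⟩, fun r s hs h => hφ.exists_mul_eq_zero r ?_⟩
  · simpa using hφ.isUnit 0 h0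
  · obtain ⟨u, hu⟩ := hφ.isUnit s hs
    obtain ⟨s', hs', r', e⟩ := hφ.exists_mul_eq (φ r * (u⁻¹ : Qˣ))
    have hdiff : φ (s' * r - r' * s) = 0 := by
      rw [map_sub, map_mul, map_mul, ← e, ← hu, ← mul_assoc, Units.inv_mul_cancel_right, sub_self]
    obtain ⟨t, ht, h⟩ := hφ.exists_mul_eq_zero _ hdiff
    rw [mul_sub, sub_eq_zero, ← mul_assoc, ← mul_assoc] at h
    exact ⟨t * s', mul_mem ht hs', t * r', h⟩
  · exact (hφ.isUnit s hs).mul_left_eq_zero.1 (by rw [← map_mul, h, map_zero])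

lemma exists_leftFrac_equiv (hφ : IsLeftFractionRing S φ) (h : S ∈ leftDen R) :
    ∃ e : LeftFrac S h ≃+* Q, ∀ r, e (LeftFrac.of h r) = φ r := by
  obtain ⟨g, hg⟩ := LeftFrac.exists_lift h hφ.isUnit
  exact ⟨.ofBijective g ((LeftFrac.isLeftFractionRing h).bijective_of_comp_eq hφ hg), hg⟩

lemma exists_lift [Nontrivial Q] {A : Type*} [Ring A] (hφ : IsLeftFractionRing S φ) {f : R →+* A}
    (hf : ∀ s ∈ S, IsUnit (f s)) : ∃ g : Q →+* A, ∀ r, g (φ r) = f r := by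
  obtain ⟨e, he⟩ := hφ.exists_leftFrac_equiv hφ.mem_leftDen
  obtain ⟨g, hg⟩ := LeftFrac.exists_lift hφ.mem_leftDen hf
  exact ⟨g.comp e.symm, fun r => by simp [← he, hg]⟩

lemma exists_localize_equiv [Nontrivial Q] (hφ : IsLeftFractionRing S φ) :
    ∃ e : Localize S ≃+* Q, ∀ r, e (Localize.of S r) = φ r := by
  obtain ⟨g, hg⟩ := Localize.exists_lift hφ.isUnit
  obtain ⟨h, hh⟩ := hφ.exists_lift fun s => Localize.isUnit_of
  exact ⟨.ofRingHom g h (hφ.hom_ext fun r => by simp [hg, hh])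
    (Localize.hom_ext fun r => by simp [hg, hh]), hg⟩

lemma ass_eq_ker [Nontrivial Q] (hφ : IsLeftFractionRing S φ) : ass S = TwoSidedIdeal.ker φ := by
  obtain ⟨e, he⟩ := hφ.exists_localize_equiv
  ext r
  rw [ass, TwoSidedIdeal.mem_ker, TwoSidedIdeal.mem_ker, ← he, e.map_eq_zero_iff]

lemma mem_leftLocalizable [Nontrivial Q] (hφ : IsLeftFractionRing S φ) :
    S ∈ leftLocalizable R := by
  obtain ⟨e, he⟩ := hφ.exists_localize_equiv
  refine ⟨hφ.mem_leftDen.1.1, e.toEquiv.nontrivial, fun q => ?_⟩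
  obtain ⟨s, hs, r, h⟩ := hφ.exists_mul_eq (e q)
  rw [← he, ← he, ← map_mul] at h
  refine ⟨⟨s, hs⟩, r, (Localize.isUnit_of hs).mul_left_cancel ?_⟩
  rw [e.injective h, ← mul_assoc, Localize.of_mul_inv ⟨s, hs⟩, one_mul]

lemma isRightFractionRing (hφ : IsLeftFractionRing S φ) (hS : S ∈ rightDen R) :
    IsRightFractionRing S φ where
  isUnit := hφ.isUnit
  exists_mul_eq q := by
    obtain ⟨s, hs, r, e⟩ := hφ.exists_mul_eq q
    obtain ⟨s', hs', r', e'⟩ := hS.1.2 r s hs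
    refine ⟨s', hs', r', (hφ.isUnit s hs).mul_left_cancel ?_⟩
    rw [← mul_assoc, e, ← map_mul, ← map_mul, e']
  exists_mul_eq_zero r hr := by
    obtain ⟨s, hs, h⟩ := hφ.exists_mul_eq_zero r hr
    exact hS.2 r s hs h

end IsLeftFractionRing

namespace IsRightFractionRing

lemma op (hφ : IsRightFractionRing S φ) : IsLeftFractionRing S.op φ.op where
  isUnit s hs := (hφ.isUnit s.unop hs).op
  exists_mul_eq q := by
    obtain ⟨s, hs, r, e⟩ := hφ.exists_mul_eq q.unop
    exact ⟨.op s, hs, .op r, MulOpposite.unop_injective e⟩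
  exists_mul_eq_zero r hr := by
    obtain ⟨s, hs, e⟩ := hφ.exists_mul_eq_zero r.unop (congrArg MulOpposite.unop hr)
    exact ⟨.op s, hs, MulOpposite.unop_injective e⟩

lemma mem_rightDen [Nontrivial Q] (hφ : IsRightFractionRing S φ) : S ∈ rightDen R :=
  mem_rightDen_iff_op.2 hφ.op.mem_leftDen

lemma exists_rightFrac_equiv (hφ : IsRightFractionRing S φ) (h : S ∈ rightDen R) :
    ∃ e : RightFrac S h ≃+* Q, ∀ r, e (RightFrac.of h r) = φ r := by
  obtain ⟨e, he⟩ := hφ.op.exists_leftFrac_equiv (op_mem_leftDen h)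
  exact ⟨e.op.trans (RingEquiv.opOp Q).symm, fun r => congrArg MulOpposite.unop (he (.op r))⟩

lemma mem_rightLocalizable [Nontrivial Q] (hφ : IsRightFractionRing S φ)
    (hφ' : IsLeftFractionRing S φ) : S ∈ rightLocalizable R := by
  obtain ⟨e, he⟩ := hφ'.exists_localize_equiv
  refine ⟨hφ'.mem_leftDen.1.1, e.toEquiv.nontrivial, fun q => ?_⟩
  obtain ⟨s, hs, r, h⟩ := hφ.exists_mul_eq (e q)
  rw [← he, ← he, ← map_mul] at h
  refine ⟨⟨s, hs⟩, r, (Localize.isUnit_of hs).mul_right_cancel ?_⟩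
  rw [e.injective h, mul_assoc, Localize.inv_mul_of ⟨s, hs⟩, mul_one]

end IsRightFractionRing

lemma exists_leftFrac_equiv_rightFrac (hl : S ∈ leftDen R) (hr : S ∈ rightDen R) :
    ∃ e : LeftFrac S hl ≃+* RightFrac S hr, ∀ r, e (LeftFrac.of hl r) = RightFrac.of hr r := by
  obtain ⟨e, he⟩ :=
    ((LeftFrac.isLeftFractionRing hl).isRightFractionRing hr).exists_rightFrac_equiv hr
  exact ⟨e.symm, fun r => by rw [← he, e.symm_apply_apply]⟩

theorem IsLeftFractionRing.isSemisimpleRing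
    (hφ : IsLeftFractionRing (nonZeroDivisors R) φ) (hsp : IsSemiprime R) (hG : IsLeftGoldie R) :
    IsSemisimpleRing Q := by
  refine { exists_isCompl := fun J => ?_ }
  obtain ⟨K, hd, hE⟩ := exists_disjoint_isEssential_sup J
  refine ⟨K, hd, codisjoint_iff.2 ?_⟩
  have hE' : IsEssential ((J ⊔ K : Ideal Q).comap φ) := isEssential_iff_exists_smul.2 fun x hx => by
    obtain ⟨q, hq0, hq⟩ := isEssential_iff_exists_smul.1 hE (φ x) <|
      (map_ne_zero_iff φ (hφ.injective le_rfl)).2 hx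
    obtain ⟨c, hc, r, hr⟩ := hφ.exists_mul_eq q
    have hrx : φ (r * x) = φ c * (q * φ x) := by rw [map_mul, ← hr, mul_assoc]
    refine ⟨r, fun h0 => hq0 ?_, Ideal.mem_comap.2 ?_⟩
    · rw [smul_eq_mul] at h0
      rw [h0, map_zero] at hrx
      exact (hφ.isUnit c hc).mul_right_eq_zero.1 hrx.symm
    · rw [smul_eq_mul, hrx]
      exact Ideal.mul_mem_left _ _ hq
  obtain ⟨c, hcE, hc⟩ := hE'.exists_mem_nonZeroDivisors hsp hG
  exact Ideal.eq_top_of_isUnit_mem _ hcE (hφ.isUnit c hc)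

theorem exists_isLeftFractionRing_pi {R : Type u} [Ring R] [Nontrivial R] (hsp : IsSemiprime R)
    (hG : IsLeftGoldie R) :
    ∃ (n : ℕ) (A : Fin n → Type u) (_ : ∀ i, Ring (A i)) (f : R →+* ∀ i, A i),
      (∀ i, IsSimpleRing (A i)) ∧ (∀ i, IsArtinianRing (A i)) ∧
        IsLeftFractionRing (nonZeroDivisors R) f := by
  have hfrac := LeftFrac.isLeftFractionRing (nonZeroDivisors_mem_leftDen hsp hG)
  have := hfrac.isSemisimpleRing hsp hG
  obtain ⟨n, D, d, _, _, ⟨e⟩⟩ := IsSemisimpleRing.exists_ringEquiv_pi_matrix_divisionRing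
    (LeftFrac (nonZeroDivisors R) _)
  exact ⟨n, fun i => Matrix (Fin (d i)) (Fin (d i)) (D i), inferInstance, _, inferInstance,
    inferInstance, hfrac.comp_ringEquiv e⟩

end Fractions

/-! ### Ore sets, prime ideals and simple Artinian rings of fractions -/

section Ore

variable {R : Type*} [Ring R] {S : Submonoid R}

lemma HasLeftAnnACC.mem_leftDen (hR : HasLeftAnnACC R) (hS : S ∈ leftOre R) : S ∈ leftDen R := by
  refine ⟨hS, fun r s hs hrs => ?_⟩
  obtain ⟨n, hn, hle⟩ := hR.exists_pow_leftAnn_mul_self_le s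
  obtain ⟨s', hs', r', e⟩ := hS.2 r (s ^ n) (S.pow_mem hs n)
  obtain ⟨k, rfl⟩ := Nat.exists_eq_succ_of_ne_zero hn
  refine ⟨s', hs', e.trans (mem_leftAnn_singleton.1 (hle (mem_leftAnn_singleton.2 ?_)))⟩
  rw [← mul_assoc, ← e, pow_succ', mul_assoc s', ← mul_assoc r, hrs, zero_mul, mul_zero]

lemma HasLeftAnnACC.mem_rightDen (hR : HasLeftAnnACC Rᵐᵒᵖ) (hS : S ∈ rightOre R) :
    S ∈ rightDen R :=
  mem_rightDen_iff_op.2 (hR.mem_leftDen (mem_rightOre_iff_op.1 hS))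

lemma ore_eq_den (hl : HasLeftAnnACC R) (hr : HasLeftAnnACC Rᵐᵒᵖ) : ore R = den R :=
  Set.Subset.antisymm (fun _ hS => ⟨hl.mem_leftDen hS.1, hr.mem_rightDen hS.2⟩)
    fun _ hS => ⟨hS.1.1, hS.2.1⟩

lemma HasLeftAnnACC.exists_mem_forall_mul_eq_zero (hR : HasLeftAnnACC R) (hS : S ∈ rightOre R) :
    ∃ s₀ ∈ S, ∀ r, ∀ s ∈ S, r * s = 0 → r * s₀ = 0 := by
  obtain ⟨s₀, hs₀, hmax⟩ := hR.exists_maximal (s := (S : Set R)) ⟨1, S.one_mem⟩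
  refine ⟨s₀, hs₀, fun r s hs hrs => ?_⟩
  obtain ⟨s', hs', r', e⟩ := hS.2 s s₀ hs₀
  have hle : leftAnn {s * s'} ≤ leftAnn {s₀} :=
    hmax _ (S.mul_mem hs hs') (e ▸ leftAnn_singleton_le_mul s₀ r')
  exact mem_leftAnn_singleton.1 (hle (leftAnn_singleton_le_mul s s' (mem_leftAnn_singleton.2 hrs)))

end Ore

section MaximalElements

variable {α κ : Type*} [PartialOrder α] {F : Set α} {C : κ → α}

lemma maxElts_eq_range (hCF : ∀ i, C i ∈ F) (hF : ∀ S ∈ F, ∃ i, S ≤ C i)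
    (hC : ∀ i j, C i ≤ C j → i = j) : maxElts F = Set.range C := by
  ext S
  constructor
  · intro hS
    obtain ⟨i, hi⟩ := hF S hS.1
    exact ⟨i, le_antisymm (hS.2 (hCF i) hi) hi⟩
  · rintro ⟨i, rfl⟩
    refine ⟨hCF i, fun T hT hiT => ?_⟩
    obtain ⟨j, hj⟩ := hF T hT
    rwa [hC i j (hiT.trans hj)]

lemma sep_maxElts_eq (F : Set α) (a : α) : {S ∈ maxElts F | a ≤ S} = maxElts {S ∈ F | a ≤ S} := by
  ext S
  exact ⟨fun h => ⟨⟨h.1.1, h.2⟩, fun T hT => h.1.2 hT.1⟩,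
    fun h => ⟨⟨h.1.1, fun T hT hST => h.2 ⟨hT, h.1.2.trans hST⟩ hST⟩, h.1.2⟩⟩

end MaximalElements

section Primes

variable {R : Type*} [Ring R] {S : Submonoid R} {P : TwoSidedIdeal R}

lemma mem_regularMod_iff {c : R} :
    c ∈ regularMod P ↔ (∀ x, c * x ∈ P → x ∈ P) ∧ ∀ x, x * c ∈ P → x ∈ P := by
  have hmk : ∀ x, P.ringCon.mk' x = 0 ↔ x ∈ P := fun x => by
    rw [← TwoSidedIdeal.mem_ker, TwoSidedIdeal.ker_ringCon_mk']
  simp only [regularMod, Submonoid.mem_comap, mem_nonZeroDivisors_iff,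
    (RingCon.mk'_surjective P.ringCon).forall, ← map_mul, hmk]

lemma IsPrimeIdeal.infPrime (hP : IsPrimeIdeal P) : InfPrime P := by
  refine ⟨fun h => hP.1 h.eq_top, fun I J hIJ => ?_⟩
  by_contra! h
  obtain ⟨a, haI, haP⟩ := SetLike.not_le_iff_exists.1 h.1
  obtain ⟨b, hbJ, hbP⟩ := SetLike.not_le_iff_exists.1 h.2
  refine (hP.2 a b fun r => hIJ ?_).elim haP hbP
  exact ⟨I.mul_mem_right _ _ (I.mul_mem_right _ _ haI), J.mul_mem_left _ _ hbJ⟩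

lemma minPrimes_eq_range {κ : Type*} [Finite κ] {P : κ → TwoSidedIdeal R}
    (hP : ∀ i, IsPrimeIdeal (P i)) (hPP : ∀ i j, P i ≤ P j → i = j) (hbot : ⨅ i, P i = ⊥) :
    minPrimes R = Set.range P := by
  have := Fintype.ofFinite κ
  have hle : ∀ I, IsPrimeIdeal I → ∃ i, P i ≤ I := fun I hI => by
    have hinf : Finset.univ.inf P ≤ I := by
      rw [Finset.inf_univ_eq_iInf, hbot]
      exact bot_le
    obtain ⟨i, -, hi⟩ := hI.infPrime.finset_inf_le.1 hinf
    exact ⟨i, hi⟩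
  ext I
  constructor
  · intro hI
    obtain ⟨i, hi⟩ := hle I hI.1
    exact ⟨i, le_antisymm hi (hI.2 (hP i) hi)⟩
  · rintro ⟨i, rfl⟩
    refine ⟨hP i, fun I hI hIi => ?_⟩
    obtain ⟨j, hj⟩ := hle I hI
    rwa [← hPP j i (hj.trans hIi)]

lemma IsPrimeIdeal.mem_of_mul_eq_zero (hP : IsPrimeIdeal P) (hS : S ∈ den R) {s₀ : R}
    (hs₀ : ∀ r, ∀ s ∈ S, r * s = 0 → r * s₀ = 0) (hs₀P : s₀ ∉ P) {r s : R} (hs : s ∈ S)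
    (hrs : r * s = 0) : r ∈ P := by
  obtain ⟨t, ht, htr⟩ := hS.1.2 r s hs hrs
  refine (hP.2 r s₀ fun x => ?_).resolve_right hs₀P
  obtain ⟨u, hu, hxu⟩ := hS.2.2 (r * x) t ht (by rw [← mul_assoc, htr, zero_mul])
  rw [hs₀ _ u hu hxu]
  exact P.zero_mem

end Primes

section Artinian

variable {R B : Type*} [Ring R] [Ring B] {S : Submonoid R} {φ : R →+* B}

/-- The multiplicative set of elements which become units under `φ`. -/
def unitPreimage (φ : R →+* B) : Submonoid R := (IsUnit.submonoid B).comap φ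

lemma mem_unitPreimage {r : R} : r ∈ unitPreimage φ ↔ IsUnit (φ r) := Iff.rfl

lemma ass_le_ker (hS : S ≤ unitPreimage φ) : ass S ≤ TwoSidedIdeal.ker φ := by
  obtain ⟨l, hl⟩ := Localize.exists_lift hS
  intro r hr
  rw [ass, TwoSidedIdeal.mem_ker] at hr
  rw [TwoSidedIdeal.mem_ker, ← hl, hr, map_zero]

variable [IsArtinianRing B]

lemma isUnit_of_forall_mul_eq_zero {b : B} (h : ∀ q, q * b = 0 → q = 0) : IsUnit b :=
  IsArtinianRing.isUnit_iff_isRightRegular.2 (isRightRegular_iff_left_eq_zero_of_mul.2 h)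

lemma exists_mem_mul_eq_of_isUnit {N : Ideal B} {u : B} (hu : IsUnit u) (hN : ∀ x ∈ N, x * u ∈ N)
    {x : B} (hx : x ∈ N) : ∃ y ∈ N, y * u = x := by
  obtain ⟨y, hy⟩ := IsArtinian.surjective_of_injective_endomorphism
    ((LinearMap.toSpanSingleton B B u).restrict hN)
    (fun y z hyz => Subtype.ext (hu.mul_right_cancel (congrArg Subtype.val hyz))) ⟨x, hx⟩
  exact ⟨y, y.2, congrArg Subtype.val hy⟩

namespace IsLeftFractionRing

lemma regularMod_ker (hφ : IsLeftFractionRing S φ) :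
    regularMod (TwoSidedIdeal.ker φ) = unitPreimage φ := by
  ext c
  simp only [mem_regularMod_iff, TwoSidedIdeal.mem_ker, map_mul, mem_unitPreimage]
  refine ⟨fun hc => isUnit_of_forall_mul_eq_zero fun q hq => ?_, fun hc =>
    ⟨fun x => hc.mul_right_eq_zero.1, fun x => hc.mul_left_eq_zero.1⟩⟩
  obtain ⟨s, hs, r, e⟩ := hφ.exists_mul_eq q
  refine (hφ.isUnit s hs).mul_right_eq_zero.1 (e.trans (hc.2 r ?_))
  rw [← e, mul_assoc, hq, mul_zero]

lemma mul_mem_of_forall_mul_mem (hφ : IsLeftFractionRing S φ) {N : Ideal B}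
    (hN : ∀ x ∈ N, ∀ r, x * φ r ∈ N) {x : B} (hx : x ∈ N) (q : B) : x * q ∈ N := by
  obtain ⟨s, hs, r, e⟩ := hφ.exists_mul_eq q
  obtain ⟨y, hy, rfl⟩ := exists_mem_mul_eq_of_isUnit (hφ.isUnit s hs) (fun x hx => hN x hx s) hx
  rw [mul_assoc, e]
  exact hN y hy r

lemma isPrimeIdeal_ker [IsSimpleRing B] (hφ : IsLeftFractionRing S φ) :
    IsPrimeIdeal (TwoSidedIdeal.ker φ) := by
  refine ⟨fun h => ?_, fun a b hab => ?_⟩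
  · have h1 : (1 : R) ∈ TwoSidedIdeal.ker φ := h ▸ TwoSidedIdeal.mem_top R
    rw [TwoSidedIdeal.mem_ker, map_one] at h1
    exact one_ne_zero h1
  simp only [TwoSidedIdeal.mem_ker] at hab ⊢
  let N : Ideal B := leftAnn (Set.range fun r => φ (r * b))
  have hN : ∀ x ∈ N, ∀ r, x * φ r ∈ N := by
    rintro x hx r _ ⟨r', rfl⟩
    rw [mul_assoc, ← map_mul, ← mul_assoc]
    exact hx _ ⟨_, rfl⟩
  have haN : φ a ∈ N := by
    rintro _ ⟨r, rfl⟩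
    rw [← map_mul, ← mul_assoc, hab]
  let I : TwoSidedIdeal B := TwoSidedIdeal.mk' N N.zero_mem N.add_mem N.neg_mem
    (N.mul_mem_left _) fun hx => hφ.mul_mem_of_forall_mul_mem hN hx _
  have hI : ∀ x, x ∈ I ↔ x ∈ N := TwoSidedIdeal.mem_mk' _ _ _ _ _ _
  by_contra! hne
  have h1 : (1 : B) ∈ N :=
    (hI 1).1 (IsSimpleRing.one_mem_of_ne_zero_mem I hne.1 ((hI _).2 haN))
  exact hne.2 (by simpa using h1 _ ⟨1, rfl⟩)

end IsLeftFractionRing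

end Artinian

lemma IsSimpleArtinian.of_ringEquiv {A B : Type*} [Ring A] [Ring B] [IsSimpleRing A]
    [IsArtinianRing A] (e : A ≃+* B) : IsSimpleArtinian B := by
  have : IsSimpleRing B := IsSimpleRing.of_ringEquiv e inferInstance
  have : IsArtinianRing B := e.isArtinianRing
  exact ⟨inferInstance, inferInstance, inferInstance⟩

/-! ### Rings of fractions which are products -/

section Product

variable {R κ : Type*} [Ring R] {A : κ → Type*} [∀ i, Ring (A i)] {f : R →+* ∀ i, A i}
  {S T : Submonoid R}

/-- The component `R → A i` of a homomorphism into a product. -/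
def component (f : R →+* ∀ i, A i) (i : κ) : R →+* A i := (Pi.evalRingHom A i).comp f

lemma component_apply (f : R →+* ∀ i, A i) (i : κ) (r : R) : component f i r = f r i := rfl

lemma iInf_ker_component (hf : Function.Injective f) :
    ⨅ i, TwoSidedIdeal.ker (component f i) = ⊥ := by
  refine eq_bot_iff.2 fun r hr => (TwoSidedIdeal.mem_bot R).2 (hf ?_)
  rw [map_zero]
  have hle : ∀ i, ⨅ i, TwoSidedIdeal.ker (component f i) ≤ TwoSidedIdeal.ker (component f i) :=
    iInf_le _
  exact funext fun i => (TwoSidedIdeal.mem_ker _).1 (hle i hr)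

lemma exists_single_injective [Finite κ] [DecidableEq κ] [∀ i, IsSimpleRing (A i)] {B : Type*}
    [Ring B] [Nontrivial B] (g : (∀ i, A i) →+* B) :
    ∃ i, ∀ q : A i, g (Pi.single i q) = 0 → q = 0 := by
  have := Fintype.ofFinite κ
  obtain ⟨i, hi⟩ : ∃ i, g (Pi.single i 1) ≠ 0 := by
    by_contra! h
    refine one_ne_zero (α := B) ?_
    rw [← map_one g, ← Finset.univ_sum_single (1 : ∀ i, A i), map_sum]
    exact Finset.sum_eq_zero fun i _ => h i
  let gi : A i →ₙ+* B :=
    { toFun q := g (Pi.single i q)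
      map_zero' := by rw [Pi.single_zero, map_zero]
      map_add' x y := by rw [Pi.single_add, map_add]
      map_mul' x y := by rw [Pi.single_mul, map_mul] }
  refine ⟨i, fun q hq => ?_⟩
  by_contra hq0
  exact hi ((TwoSidedIdeal.mem_ker gi).1
    (IsSimpleRing.one_mem_of_ne_zero_mem _ hq0 ((TwoSidedIdeal.mem_ker gi).2 hq)))

namespace IsLeftFractionRing

section Component

variable (hf : IsLeftFractionRing T f)
include hf

lemma le_unitPreimage_component (i : κ) : T ≤ unitPreimage (component f i) :=
  fun t ht => (hf.isUnit t ht).map (Pi.evalRingHom A i)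

lemma exists_mem_unitPreimage_component (i : κ) :
    ∃ t ∈ unitPreimage (component f i), ∀ j ≠ i, f t j = 0 := by
  classical
  obtain ⟨s, hs, t, e⟩ := hf.exists_mul_eq (Pi.single i 1)
  refine ⟨t, ?_, fun j hj => ?_⟩
  · have hst : f s i = f t i := by simpa using congrFun e i
    rw [mem_unitPreimage, component_apply, ← hst]
    exact hf.le_unitPreimage_component i hs
  · rw [← e, Pi.mul_apply, Pi.single_eq_of_ne hj, mul_zero]

lemma isLeftFractionRing_component (i : κ) :
    IsLeftFractionRing (unitPreimage (component f i)) (component f i) where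
  isUnit _ := id
  exists_mul_eq q := by
    classical
    obtain ⟨s, hs, r, e⟩ := hf.exists_mul_eq (Pi.single i q)
    exact ⟨s, hf.le_unitPreimage_component i hs, r, by simpa [component_apply] using congrFun e i⟩
  exists_mul_eq_zero r hr := by
    obtain ⟨t, ht, ht0⟩ := hf.exists_mem_unitPreimage_component i
    have htr : f (t * r) = 0 := funext fun j => by
      rw [map_mul, Pi.mul_apply]
      obtain rfl | hj := eq_or_ne j i
      · exact mul_eq_zero_of_right _ hr
      · rw [ht0 j hj, zero_mul, Pi.zero_apply]
    obtain ⟨s, hs, h⟩ := hf.exists_mul_eq_zero _ htr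
    exact ⟨s * t, mul_mem (hf.le_unitPreimage_component i hs) ht, by rw [mul_assoc, h]⟩

lemma eq_of_unitPreimage_component_le [∀ i, Nontrivial (A i)] {i j : κ}
    (h : unitPreimage (component f i) ≤ unitPreimage (component f j)) : i = j := by
  obtain ⟨t, ht, ht0⟩ := hf.exists_mem_unitPreimage_component i
  by_contra hij
  exact (h ht).ne_zero (ht0 j (Ne.symm hij))

lemma eq_of_ker_component_le [∀ i, Nontrivial (A i)] {i j : κ}
    (h : TwoSidedIdeal.ker (component f i) ≤ TwoSidedIdeal.ker (component f j)) :
    i = j := by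
  obtain ⟨t, ht, ht0⟩ := hf.exists_mem_unitPreimage_component j
  by_contra hij
  exact ht.ne_zero ((TwoSidedIdeal.mem_ker _).1 (h ((TwoSidedIdeal.mem_ker _).2 (ht0 i hij))))

lemma isRightFractionRing_component (hr : IsRightFractionRing T f) (i : κ) :
    IsRightFractionRing (unitPreimage (component f i)) (component f i) where
  isUnit _ := id
  exists_mul_eq q := by
    classical
    obtain ⟨s, hs, r, e⟩ := hr.exists_mul_eq (Pi.single i q)
    exact ⟨s, hf.le_unitPreimage_component i hs, r, by simpa [component_apply] using congrFun e i⟩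
  exists_mul_eq_zero r hr0 := by
    obtain ⟨t, ht, ht0⟩ := hf.exists_mem_unitPreimage_component i
    have hrt : f (r * t) = 0 := funext fun j => by
      rw [map_mul, Pi.mul_apply]
      obtain rfl | hj := eq_or_ne j i
      · exact mul_eq_zero_of_left hr0 _
      · rw [ht0 j hj, mul_zero, Pi.zero_apply]
    obtain ⟨s, hs, h⟩ := hr.exists_mul_eq_zero _ hrt
    exact ⟨t * s, mul_mem ht (hf.le_unitPreimage_component i hs), by rw [← mul_assoc, h]⟩

end Component

section SimpleArtinian

variable [∀ i, IsSimpleRing (A i)] [∀ i, IsArtinianRing (A i)]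

lemma exists_le_unitPreimage_of_mem_den (hf : IsLeftFractionRing T f)
    (hinj : Function.Injective f) (hR : HasLeftAnnACC R) (hS : S ∈ den R) :
    ∃ i, S ≤ unitPreimage (component f i) := by
  classical
  obtain ⟨s₀, hs₀S, hs₀⟩ := hR.exists_mem_forall_mul_eq_zero hS.2.1
  have hfs₀ : f s₀ ≠ 0 := fun h =>
    hS.1.1.1 (hinj (h.trans (map_zero f).symm) ▸ hs₀S)
  obtain ⟨i, hi⟩ := Function.ne_iff.1 hfs₀
  have hP := (hf.isLeftFractionRing_component i).isPrimeIdeal_ker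
  have hs₀P : s₀ ∉ TwoSidedIdeal.ker (component f i) := (TwoSidedIdeal.mem_ker _).not.2 hi
  refine ⟨i, fun s hs => isUnit_of_forall_mul_eq_zero fun q hq => ?_⟩
  obtain ⟨t, ht, r, e⟩ := hf.exists_mul_eq (Pi.single i q)
  have hrs : r * s = 0 := hinj <| by
    rw [map_mul, ← e, mul_assoc, ← Pi.single_mul_left, ← component_apply, hq, Pi.single_zero,
      mul_zero, map_zero]
  have hr : component f i r = 0 :=
    (TwoSidedIdeal.mem_ker _).1 (hP.mem_of_mul_eq_zero hS hs₀ hs₀P hs hrs)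
  refine (hf.le_unitPreimage_component i ht).mul_right_eq_zero.1 ?_
  rw [← hr, component_apply f i r, ← e, component_apply, Pi.mul_apply, Pi.single_eq_same]

lemma exists_le_unitPreimage_of_nontrivial_localize [Finite κ] (hf : IsLeftFractionRing T f)
    (hTS : T ≤ S) [Nontrivial (Localize S)] : ∃ i, S ≤ unitPreimage (component f i) := by
  classical
  have hT : ∀ t ∈ T, IsUnit (Localize.of S t) := fun t ht => Localize.isUnit_of (hTS ht)
  have := hf.nontrivial hT
  obtain ⟨g, hg⟩ := hf.exists_lift hT
  obtain ⟨i, hi⟩ := exists_single_injective g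
  refine ⟨i, fun s hs => isUnit_of_forall_mul_eq_zero fun q hq => hi q ?_⟩
  refine (Localize.isUnit_of hs).mul_left_eq_zero.1 ?_
  rw [← hg, ← map_mul, ← Pi.single_mul_left, ← component_apply, hq, Pi.single_zero, map_zero]

lemma maxElts_ore (hf : IsLeftFractionRing T f) (hr : IsRightFractionRing T f)
    (hinj : Function.Injective f) (hRl : HasLeftAnnACC R) (hRr : HasLeftAnnACC Rᵐᵒᵖ) :
    maxElts (ore R) = Set.range fun i => unitPreimage (component f i) := by
  rw [ore_eq_den hRl hRr]
  exact maxElts_eq_range (fun i => ⟨(hf.isLeftFractionRing_component i).mem_leftDen,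
      (hf.isRightFractionRing_component hr i).mem_rightDen⟩)
    (fun _ => hf.exists_le_unitPreimage_of_mem_den hinj hRl)
    fun _ _ => hf.eq_of_unitPreimage_component_le

lemma ass_image_maxElts_ore (hf : IsLeftFractionRing T f) (hr : IsRightFractionRing T f)
    (hinj : Function.Injective f) (hRl : HasLeftAnnACC R) (hRr : HasLeftAnnACC Rᵐᵒᵖ) :
    ass '' maxElts (ore R) = Set.range fun i => TwoSidedIdeal.ker (component f i) := by
  rw [hf.maxElts_ore hr hinj hRl hRr, ← Set.range_comp]
  exact congrArg Set.range (funext fun i => (hf.isLeftFractionRing_component i).ass_eq_ker)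

lemma isSimpleArtinian_localize (hf : IsLeftFractionRing T f) (i : κ) :
    IsSimpleArtinian (Localize (unitPreimage (component f i))) := by
  obtain ⟨e, -⟩ := (hf.isLeftFractionRing_component i).exists_localize_equiv
  exact IsSimpleArtinian.of_ringEquiv e.symm

lemma sep_maxElts_eq_range [Finite κ] (hf : IsLeftFractionRing T f) {F : Set (Submonoid R)}
    (hF : ∀ i, unitPreimage (component f i) ∈ F) (hnt : ∀ S ∈ F, Nontrivial (Localize S)) :
    {S ∈ maxElts F | T ≤ S} = Set.range fun i => unitPreimage (component f i) := by
  rw [sep_maxElts_eq]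
  refine maxElts_eq_range (fun i => ⟨hF i, hf.le_unitPreimage_component i⟩) (fun S hS => ?_)
    fun _ _ => hf.eq_of_unitPreimage_component_le
  have := hnt S hS.1
  exact hf.exists_le_unitPreimage_of_nontrivial_localize hS.2

lemma sep_maxElts_leftLocalizable [Finite κ] (hf : IsLeftFractionRing T f) :
    {S ∈ maxElts (leftLocalizable R) | T ≤ S} =
      Set.range fun i => unitPreimage (component f i) :=
  hf.sep_maxElts_eq_range (fun i => (hf.isLeftFractionRing_component i).mem_leftLocalizable)
    fun _ hS => hS.2.1

lemma sep_maxElts_rightLocalizable [Finite κ] (hf : IsLeftFractionRing T f)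
    (hr : IsRightFractionRing T f) :
    {S ∈ maxElts (rightLocalizable R) | T ≤ S} =
      Set.range fun i => unitPreimage (component f i) :=
  hf.sep_maxElts_eq_range (fun i => (hf.isRightFractionRing_component hr i).mem_rightLocalizable
    (hf.isLeftFractionRing_component i)) fun _ hS => hS.2.1

lemma sep_maxElts_localizable [Finite κ] (hf : IsLeftFractionRing T f)
    (hr : IsRightFractionRing T f) :
    {S ∈ maxElts (localizable R) | T ≤ S} = Set.range fun i => unitPreimage (component f i) :=
  hf.sep_maxElts_eq_range (F := localizable R)
    (fun i => ⟨(hf.isLeftFractionRing_component i).mem_leftLocalizable,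
      (hf.isRightFractionRing_component hr i).mem_rightLocalizable
        (hf.isLeftFractionRing_component i)⟩)
    fun _ hS => hS.1.2.1

lemma maxElts_ass (hf : IsLeftFractionRing T f) (hr : IsRightFractionRing T f)
    (hinj : Function.Injective f) (hRl : HasLeftAnnACC R) (hRr : HasLeftAnnACC Rᵐᵒᵖ) :
    maxElts (ass '' ore R) = Set.range fun i => TwoSidedIdeal.ker (component f i) := by
  rw [ore_eq_den hRl hRr]
  refine maxElts_eq_range (fun i => ⟨_, ⟨(hf.isLeftFractionRing_component i).mem_leftDen,
      (hf.isRightFractionRing_component hr i).mem_rightDen⟩,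
    (hf.isLeftFractionRing_component i).ass_eq_ker⟩)
    ?_ fun _ _ => hf.eq_of_ker_component_le
  rintro _ ⟨S, hS, rfl⟩
  obtain ⟨i, hi⟩ := hf.exists_le_unitPreimage_of_mem_den hinj hRl hS
  exact ⟨i, ass_le_ker hi⟩

lemma minPrimes_eq_range_ker [Finite κ] (hf : IsLeftFractionRing T f)
    (hinj : Function.Injective f) :
    minPrimes R = Set.range fun i => TwoSidedIdeal.ker (component f i) :=
  minPrimes_eq_range (fun i => (hf.isLeftFractionRing_component i).isPrimeIdeal_ker)
    (fun _ _ => hf.eq_of_ker_component_le) (iInf_ker_component hinj)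

lemma regularMod_image_minPrimes [Finite κ] (hf : IsLeftFractionRing T f)
    (hinj : Function.Injective f) :
    regularMod '' minPrimes R = Set.range fun i => unitPreimage (component f i) := by
  rw [hf.minPrimes_eq_range_ker hinj, ← Set.range_comp]
  exact congrArg Set.range (funext fun i => (hf.isLeftFractionRing_component i).regularMod_ker)

end SimpleArtinian

lemma exists_pi_localize_equiv [∀ i, Nontrivial (A i)] (hf : IsLeftFractionRing T f)
    {F : Set (Submonoid R)} (hF : F = Set.range fun i => unitPreimage (component f i)) :
    ∃ e : (∀ i, A i) ≃+* (∀ S : F, Localize (S : Submonoid R)),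
      ∀ r, e (f r) = fun S : F => Localize.of (S : Submonoid R) r := by
  subst hF
  choose e he using fun i => (hf.isLeftFractionRing_component i).exists_localize_equiv
  let m := Equiv.ofInjective (fun i => unitPreimage (component f i)) fun _ _ h =>
    hf.eq_of_unitPreimage_component_le h.le
  let B := fun S : Set.range fun i => unitPreimage (component f i) => Localize (S : Submonoid R)
  let e' : (∀ i, A i) ≃+* ∀ i, B (m i) := RingEquiv.piCongrRight fun i => (e i).symm
  refine ⟨e'.trans (RingEquiv.piCongrLeft B m), fun r => funext fun S => ?_⟩
  obtain ⟨i, rfl⟩ := m.surjective S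
  refine (Equiv.piCongrLeft_apply_apply B m _ i).trans ?_
  exact (e i).symm_apply_eq.2 (he i r).symm

end IsLeftFractionRing
end Product

end LocSets

theorem mainTheorem1 {R : Type*} [Ring R] [Nontrivial R]
    (hsp : LocSets.IsSemiprime R) (hG : LocSets.IsGoldie R) :
    -- the five sets coincide with the set of all `C(p)`, `p` a minimal prime
    (LocSets.maxElts (LocSets.ore R) = LocSets.maxElts (LocSets.den R) ∧
      LocSets.maxElts (LocSets.den R) = LocSets.regularMod '' LocSets.minPrimes R ∧
      LocSets.regularMod '' LocSets.minPrimes R =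
        {S ∈ LocSets.maxElts (LocSets.leftLocalizable R) | nonZeroDivisors R ≤ S} ∧
      LocSets.regularMod '' LocSets.minPrimes R =
        {S ∈ LocSets.maxElts (LocSets.rightLocalizable R) | nonZeroDivisors R ≤ S} ∧
      LocSets.regularMod '' LocSets.minPrimes R =
        {S ∈ LocSets.maxElts (LocSets.localizable R) | nonZeroDivisors R ≤ S}) ∧
    -- the localizations at the maximal Ore sets are simple Artinian
    (∀ S ∈ LocSets.maxElts (LocSets.ore R), LocSets.IsSimpleArtinian (LocSets.Localize S)) ∧
    -- the left and right classical quotient rings exist, are `R`-isomorphic, and are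
    -- `R`-isomorphic to the product of the localizations at the maximal Ore sets
    (∃ (hl : nonZeroDivisors R ∈ LocSets.leftDen R) (hr : nonZeroDivisors R ∈ LocSets.rightDen R),
      (∃ e : LocSets.LeftFrac (nonZeroDivisors R) hl ≃+*
          LocSets.RightFrac (nonZeroDivisors R) hr,
        ∀ r : R, e (LocSets.LeftFrac.of hl r) = LocSets.RightFrac.of hr r) ∧
      (∃ e : LocSets.LeftFrac (nonZeroDivisors R) hl ≃+*
          ((S : LocSets.maxElts (LocSets.ore R)) → LocSets.Localize (S : Submonoid R)),
        ∀ r : R, e (LocSets.LeftFrac.of hl r) =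
          fun S : LocSets.maxElts (LocSets.ore R) => LocSets.Localize.of (S : Submonoid R) r)) ∧
    -- the ideals `ass(S)`
    (LocSets.maxElts (LocSets.ass '' LocSets.ore R) =
        LocSets.ass '' LocSets.maxElts (LocSets.ore R) ∧
      LocSets.ass '' LocSets.maxElts (LocSets.ore R) = LocSets.minPrimes R ∧
      IsAntichain (· ≤ ·) (LocSets.ass '' LocSets.maxElts (LocSets.ore R))) := by
  have hl := LocSets.nonZeroDivisors_mem_leftDen hsp hG.1
  have hr := LocSets.nonZeroDivisors_mem_rightDen hsp hG.2
  have hden := LocSets.ore_eq_den hG.1.hasLeftAnnACC hG.2.hasLeftAnnACC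
  obtain ⟨n, A, _, f, _, _, hf⟩ := LocSets.exists_isLeftFractionRing_pi hsp hG.1
  have hfr := hf.isRightFractionRing hr
  have hinj := hf.injective le_rfl
  have hore := hf.maxElts_ore hfr hinj hG.1.hasLeftAnnACC hG.2.hasLeftAnnACC
  have hmax := hf.maxElts_ass hfr hinj hG.1.hasLeftAnnACC hG.2.hasLeftAnnACC
  have hass := hf.ass_image_maxElts_ore hfr hinj hG.1.hasLeftAnnACC hG.2.hasLeftAnnACC
  have hC := hf.regularMod_image_minPrimes hinj
  obtain ⟨e, he⟩ := hf.exists_leftFrac_equiv hl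
  obtain ⟨k, hk⟩ := hf.exists_pi_localize_equiv hore
  refine ⟨⟨by rw [hden], by rw [← hden, hore, hC],
      hC.trans hf.sep_maxElts_leftLocalizable.symm,
      hC.trans (hf.sep_maxElts_rightLocalizable hfr).symm,
      hC.trans (hf.sep_maxElts_localizable hfr).symm⟩,
    by simpa only [hore, Set.forall_mem_range] using hf.isSimpleArtinian_localize,
    ⟨hl, hr, LocSets.exists_leftFrac_equiv_rightFrac hl hr,
      e.trans k, fun r => by rw [RingEquiv.trans_apply, he, hk]⟩,
    hmax.trans hass.symm, hass.trans (hf.minPrimes_eq_range_ker hinj).symm, ?_⟩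
  rw [hass, ← hmax]
  exact setOfPred_maximal_antichain _
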